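/- Let $n_1,n_2\ge 0$ be integers and let $\mathcal K^1\subseteq\mathbb R^{n_1}$ and $\mathcal K^2\subseteq\mathbb R^{n_2}$ be nonempty closed convex cones, with $\mathcal K^2$ polyhedral (an intersection of finitely many closed half-spaces). Put $n=n_1+n_2$, $\mathbb R^n=\mathbb R^{n_1}\times\mathbb R^{n_2}$ with the Euclidean inner product $\langle\cdot,\cdot\rangle$, and $\mathcal K=\mathcal K^1\times\mathcal K^2\subseteq\mathbb R^n$. Let $\mathcal L\subseteq\mathbb R^n$ be a linear subspace and $c\in\mathbb R^n$. Write $\mathrm{ri}$ for the relative interior, $\mathcal K^*=\{x\in\mathbb R^n : \langle y,x\rangle\ge 0 \text{ for all } y\in\mathcal K\}$ for the dual cone, and $U^\perp$ for the subspace of vectors orthogonal to every element of the set $U$. Then $$(\mathcal L+c)\cap\bigl((\mathrm{ri}\,\mathcal K^1)\times\mathcal K^2\bigr)=\emptyset$$ if and only if at least one of the following conditions holds: (a) there exists $x\in\mathcal K^*\cap\mathcal L^\perp$ such that $\langle c,x\rangle<0$; (b) there exists $x=(x_1,x_2)\in\mathcal K^*\cap\mathcal L^\perp\cap\{c\}^\perp$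 (with $x_i\in\mathbb R^{n_i}$) such that $x_1\notin(\mathcal K^1)^\perp$. -/

import Mathlib

open scoped Pointwise InnerProductSpace

/-- A polyhedral convex set: the solution set of finitely many (not necessarily homogeneous) linear
inequalities `⟪a, x⟫ ≤ b`. -/
def IsPolyhedralSet {E : Type*} [NormedAddCommGroup E] [InnerProductSpace ℝ E] (s : Set E) : Prop :=
  ∃ S : Finset (E × ℝ), s = {x : E | ∀ p ∈ S, ⟪p.1, x⟫_ℝ ≤ p.2}

/-- The product `ℝⁿ¹ × ℝⁿ²` with the Euclidean inner product
`⟪(x₁, x₂), (y₁, y₂)⟫ = ⟪x₁, y₁⟫ + ⟪x₂, y₂⟫`, that is, `ℝⁿ` with `n = n₁ + n₂`. -/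
abbrev EuclideanProd (n₁ n₂ : ℕ) : Type :=
  WithLp 2 (EuclideanSpace ℝ (Fin n₁) × EuclideanSpace ℝ (Fin n₂))

/-- The Cartesian product `A × B` of two sets, as a subset of `ℝⁿ¹ × ℝⁿ²`. -/
def setProd {n₁ n₂ : ℕ} (A : Set (EuclideanSpace ℝ (Fin n₁))) (B : Set (EuclideanSpace ℝ (Fin n₂))) :
    Set (EuclideanProd n₁ n₂) :=
  {z | z.fst ∈ A ∧ z.snd ∈ B}

/-!
A common point `y` of `L + c` and `ri K₁ × K₂` satisfies `⟪y, x⟫ = ⟪c, x⟫` for each multiplier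
`x ∈ K* ∩ Lᗮ`. This excludes `⟪c, x⟫ < 0`; and if `⟪c, x⟫ = 0`, then `⟪y₁, x₁⟫ = 0` at the relative
interior point `y₁`, so `x₁` is orthogonal to `K₁`
(`ProperCone.mem_orthogonal_span_of_inner_eq_zero`).

Conversely, let the intersection be empty and put `V = span K₁`. The proof separates `K₁` only inside
`V`, where its relative interior is open, and leaves everything else to Farkas' lemma, which needs no
closure or interior because `K₂` is polyhedral. Consider the polyhedron `F` of all `y ∈ L + c` with
`y₁ ∈ V` and `y₂ ∈ K₂`.

* If `F` is empty, Farkas' lemma yields `x ∈ Lᗮ` with `x₁ ∈ Vᗮ`, `x₂ ∈ K₂*` and `⟪c, x⟫ < 0`.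
* Otherwise the projection of `F` to the first factor is a nonempty convex subset of `V` that misses
  `ri K₁`. Hahn–Banach in `V` gives `g` with `g ≥ 0` on `K₁`, `g ≤ 0` on that projection and `g` not
  orthogonal to `K₁` (`ProperCone.exists_separating`). The inequality `⟪g, y₁⟫ ≤ 0` follows from the
  linear system defining `F`, so Farkas' lemma yields `x ∈ Lᗮ` with `x₁ ∈ g + Vᗮ`, `x₂ ∈ K₂*` and
  `⟪c, x⟫ ≤ 0`. Then `x ∈ K*` and `x₁ ∉ K₁ᗮ`; strict inequality gives the first alternative and
  equality the second.

Both uses of Farkas' lemma are instances of `exists_multiplier`, in which the system is homogenized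
by a variable `τ ≥ 0`.
-/

/-! ### Farkas' lemma -/

/-- **Farkas' lemma**, for finitely many homogeneous inequalities `0 ≤ a i z` together with a linear
equation `T z = 0`. -/
theorem farkas_linear {ι Z W : Type*} [AddCommGroup Z] [Module ℝ Z] [AddCommGroup W] [Module ℝ W]
    (T : Z →ₗ[ℝ] W) (s : Finset ι) (a : ι → Z →ₗ[ℝ] ℝ) (b : Z →ₗ[ℝ] ℝ)
    (h : ∀ z, T z = 0 → (∀ i ∈ s, 0 ≤ a i z) → 0 ≤ b z) :
    ∃ (w : ι → ℝ) (ψ : W →ₗ[ℝ] ℝ), (∀ i ∈ s, 0 ≤ w i) ∧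
      ∀ z, b z = ∑ i ∈ s, w i * a i z + ψ (T z) := by
  classical
  induction s using Finset.induction_on generalizing a b with
  | empty =>
    have hker : LinearMap.ker T ≤ LinearMap.ker b := by
      intro z hz
      have hz' : T z = 0 := hz
      have h1 := h z hz' (by simp)
      have h2 := h (-z) (by simp [hz']) (by simp)
      rw [map_neg] at h2
      exact le_antisymm (by linarith) h1
    have hb : b ∈ LinearMap.range T.dualMap := by
      rw [LinearMap.range_dualMap_eq_dualAnnihilator_ker, Submodule.mem_dualAnnihilator]
      exact fun z hz ↦ hker hz
    obtain ⟨ψ, rfl⟩ := hb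
    exact ⟨0, ψ, by simp, by simp⟩
  | insert k s hk ih =>
    by_cases hs : ∀ z, T z = 0 → (∀ i ∈ s, 0 ≤ a i z) → 0 ≤ b z
    · obtain ⟨w, ψ, hw, hb⟩ := ih a b hs
      refine ⟨Function.update w k 0, ψ, ?_, fun z ↦ ?_⟩
      · intro i hi
        by_cases hik : i = k
        · simp [hik]
        · simpa [hik] using hw i (Finset.mem_of_mem_insert_of_ne hi hik)
      · rw [hb z, Finset.sum_insert hk, Function.update_self, zero_mul, zero_add]
        congr 1
        refine Finset.sum_congr rfl fun i hi ↦ ?_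
        rw [Function.update_of_ne (ne_of_mem_of_not_mem hi hk)]
    · push Not at hs
      obtain ⟨z₁, hT₁, ha₁, hb₁⟩ := hs
      have hk₁ : a k z₁ < 0 := by
        by_contra! hk₁
        exact absurd (h z₁ hT₁ (by simpa using ⟨hk₁, ha₁⟩)) (not_le.mpr hb₁)
      obtain ⟨z₀, hT, ha, hb, hak⟩ : ∃ z₀, T z₀ = 0 ∧ (∀ i ∈ s, 0 ≤ a i z₀) ∧ b z₀ < 0 ∧
          a k z₀ = -1 := by
        have hpos : 0 < (-a k z₁)⁻¹ := by simpa using hk₁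
        refine ⟨(-a k z₁)⁻¹ • z₁, by simp [hT₁], fun i hi ↦ ?_, ?_, ?_⟩
        · simpa using mul_nonneg hpos.le (ha₁ i hi)
        · simpa using mul_neg_of_pos_of_neg hpos hb₁
        · have := hk₁.ne
          simp only [map_smul, smul_eq_mul]
          field_simp
      -- Composing with the projection `z ↦ z + a k z • z₀` onto the kernel of `a k` removes the
      -- inequality `0 ≤ a k z`.
      obtain ⟨w, ψ, hw, hψ⟩ := ih (fun i ↦ a i + a i z₀ • a k) (b + b z₀ • a k) (by
        intro z hz hi
        have := h (z + a k z • z₀) (by simp [hz, hT]) (by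
          intro i hi'
          rcases Finset.mem_insert.mp hi' with rfl | hi'
          · simp [hak]
          · simpa [mul_comm] using hi i hi')
        simpa [mul_comm] using this)
      have hw' : ∀ i ∈ s, Function.update w k (∑ i ∈ s, w i * a i z₀ - b z₀) i = w i :=
        fun i hi ↦ Function.update_of_ne (ne_of_mem_of_not_mem hi hk) _ _
      refine ⟨Function.update w k (∑ i ∈ s, w i * a i z₀ - b z₀), ψ, fun i hi ↦ ?_, fun z ↦ ?_⟩
      · rcases Finset.mem_insert.mp hi with rfl | hi
        · rw [Function.update_self]
          have := Finset.sum_nonneg fun j hj ↦ mul_nonneg (hw j hj) (ha j hj)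
          linarith
        · exact (hw' i hi).symm ▸ hw i hi
      · have := hψ z
        simp only [LinearMap.add_apply, LinearMap.smul_apply, smul_eq_mul, mul_add,
          Finset.sum_add_distrib, ← mul_assoc, ← Finset.sum_mul] at this
        have hsum : ∑ i ∈ s, Function.update w k (∑ i ∈ s, w i * a i z₀ - b z₀) i * a i z =
            ∑ i ∈ s, w i * a i z := Finset.sum_congr rfl fun i hi ↦ by rw [hw' i hi]
        rw [Finset.sum_insert hk, Function.update_self, hsum]
        linarith

/-! ### Closed convex cones -/

section Cone

variable {E : Type*} [NormedAddCommGroup E] [InnerProductSpace ℝ E]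

/-- A linear functional bounded above on a cone is nonpositive there. -/
theorem ProperCone.inner_nonpos_of_bddAbove (K : ProperCone ℝ E) {a x : E} {b : ℝ}
    (h : ∀ y ∈ K, ⟪a, y⟫_ℝ ≤ b) (hx : x ∈ K) : ⟪a, x⟫_ℝ ≤ 0 := by
  by_contra! hpos
  have h0 : 0 ≤ b := by simpa using h 0 K.zero_mem
  have h1 := h ((b / ⟪a, x⟫_ℝ + 1) • x) (K.smul_mem hx (by positivity))
  rw [inner_smul_right, add_mul, div_mul_cancel₀ _ hpos.ne'] at h1
  linarith

/-- A polyhedral cone is cut out by finitely many homogeneous inequalities. -/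
theorem IsPolyhedralSet.exists_homogeneous {K : ProperCone ℝ E}
    (hK : IsPolyhedralSet (K : Set E)) :
    ∃ S : Finset (E × ℝ), ∀ x, x ∈ K ↔ ∀ p ∈ S, ⟪p.1, x⟫_ℝ ≤ 0 := by
  obtain ⟨S, hS⟩ := hK
  have hmem : ∀ x, x ∈ K ↔ ∀ p ∈ S, ⟪p.1, x⟫_ℝ ≤ p.2 := fun x ↦ Set.ext_iff.mp hS x
  refine ⟨S, fun x ↦ ⟨fun hx p hp ↦
    K.inner_nonpos_of_bddAbove (fun y hy ↦ (hmem y).mp hy p hp) hx, fun hx ↦ (hmem x).mpr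
      fun p hp ↦ (hx p hp).trans ?_⟩⟩
  simpa using (hmem 0).mp K.zero_mem p hp

/-- The relative interior of a cone is its interior in its linear span. -/
theorem ProperCone.mem_intrinsicInterior_iff (K : ProperCone ℝ E) {x : E} :
    x ∈ intrinsicInterior ℝ (K : Set E) ↔
      ∃ y : Submodule.span ℝ (K : Set E),
        y ∈ interior ((↑) ⁻¹' (K : Set E) : Set (Submodule.span ℝ (K : Set E))) ∧ (y : E) = x := by
  have h : affineSpan ℝ (K : Set E) = (Submodule.span ℝ (K : Set E)).toAffineSubspace := by
    have h0 : insert 0 (K : Set E) = K := Set.insert_eq_of_mem K.zero_mem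
    apply SetLike.coe_injective
    rw [← h0, affineSpan_insert_zero, h0]
    rfl
  rw [mem_intrinsicInterior, h]
  rfl

/-- A functional that is nonnegative on a cone and vanishes at a relative interior point has a local
minimum there, hence vanishes on the span of the cone. -/
theorem ProperCone.mem_orthogonal_span_of_inner_eq_zero (K : ProperCone ℝ E) {x y : E}
    (hx : ∀ z ∈ K, 0 ≤ ⟪x, z⟫_ℝ) (hy : y ∈ intrinsicInterior ℝ (K : Set E))
    (hxy : ⟪x, y⟫_ℝ = 0) : x ∈ (Submodule.span ℝ (K : Set E))ᗮ := by
  obtain ⟨y, hyK, rfl⟩ := K.mem_intrinsicInterior_iff.mp hy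
  let f : Submodule.span ℝ (K : Set E) →L[ℝ] ℝ := (innerSL ℝ x).comp (Submodule.subtypeL _)
  have hf : IsLocalMin f y := by
    filter_upwards [mem_interior_iff_mem_nhds.mp hyK] with z hz
    exact hxy.le.trans (hx z hz)
  have h0 : f = 0 := hf.hasFDerivAt_eq_zero f.hasFDerivAt
  rw [Submodule.mem_orthogonal']
  exact fun u hu ↦ DFunLike.congr_fun h0 ⟨u, hu⟩

variable [FiniteDimensional ℝ E]

/-- Proper separation of a cone from a convex subset of its span: the functional does not vanish on
the cone. -/
theorem ProperCone.exists_separating (K : ProperCone ℝ E) {D : Set E} (hD : Convex ℝ D)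
    (hne : D.Nonempty) (hDV : D ⊆ Submodule.span ℝ (K : Set E))
    (hdisj : Disjoint D (intrinsicInterior ℝ (K : Set E))) :
    ∃ g : E, (∀ z ∈ K, 0 ≤ ⟪g, z⟫_ℝ) ∧ (∀ d ∈ D, ⟪g, d⟫_ℝ ≤ 0) ∧
      g ∉ (Submodule.span ℝ (K : Set E))ᗮ := by
  set V := Submodule.span ℝ (K : Set E)
  let K' : Set V := (↑) ⁻¹' (K : Set E)
  let D' : Set V := (↑) ⁻¹' D
  have hKc : Convex ℝ (K : Set E) := (K : PointedCone ℝ E).convex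
  have hK'c : Convex ℝ K' := hKc.linear_preimage V.subtype
  have hint : (interior K').Nonempty := by
    obtain ⟨x, hx⟩ := Set.Nonempty.intrinsicInterior hKc ⟨0, K.zero_mem⟩
    obtain ⟨y, hy, -⟩ := K.mem_intrinsicInterior_iff.mp hx
    exact ⟨y, hy⟩
  obtain ⟨f, u, hfK, hfD⟩ := geometric_hahn_banach_open hK'c.interior isOpen_interior
    (hD.linear_preimage V.subtype : Convex ℝ D') (Set.disjoint_left.mpr fun y hy hyD ↦
      Set.disjoint_left.mp hdisj hyD (K.mem_intrinsicInterior_iff.mpr ⟨y, hy, rfl⟩))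
  have hle : ∀ y ∈ K', f y ≤ u := by
    intro y hy
    have hcl : y ∈ closure (interior K') := by
      rw [hK'c.closure_interior_eq_closure_of_nonempty_interior hint]
      exact subset_closure hy
    exact closure_minimal (fun a ha ↦ (hfK a ha).le)
      (isClosed_le f.continuous continuous_const) hcl
  let v : V := (InnerProductSpace.toDual ℝ V).symm f
  have hv : ∀ y : V, ⟪(v : E), (y : E)⟫_ℝ = f y := fun y ↦
    InnerProductSpace.toDual_symm_apply (x := y) (y := f)
  have hKV : ∀ z ∈ K, z ∈ V := fun z hz ↦ Submodule.subset_span hz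
  have hu : 0 ≤ u := by simpa using hle 0 (by simp [K'])
  refine ⟨-(v : E), fun z hz ↦ ?_, fun d hd ↦ ?_, fun hperp ↦ ?_⟩
  · rw [inner_neg_left, neg_nonneg]
    refine K.inner_nonpos_of_bddAbove (b := u) (fun y hy ↦ ?_) hz
    rw [hv ⟨y, hKV y hy⟩]
    exact hle _ hy
  · rw [inner_neg_left, neg_nonpos, hv ⟨d, hDV hd⟩]
    exact hu.trans (hfD _ hd)
  · have hf0 : ∀ y : V, f y = 0 := fun y ↦ by
      have := (Submodule.mem_orthogonal' _ _).mp hperp y y.2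
      rw [inner_neg_left, neg_eq_zero] at this
      rw [← hv, this]
    -- `f = 0` contradicts the strict inequality at an interior point of the cone.
    obtain ⟨a, ha⟩ := hint
    obtain ⟨d, hd⟩ := hne
    have h1 := hfK a ha
    have h2 := hfD ⟨d, hDV hd⟩ hd
    rw [hf0] at h1 h2
    linarith

end Cone

/-! ### Intersections of an affine subspace with a product of cones -/

section Product

variable {n₁ n₂ : ℕ}

theorem mem_innerDual_setProd (K₁ : ProperCone ℝ (EuclideanSpace ℝ (Fin n₁)))
    (K₂ : ProperCone ℝ (EuclideanSpace ℝ (Fin n₂))) (x : EuclideanProd n₁ n₂) :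
    x ∈ ProperCone.innerDual (setProd (K₁ : Set _) (K₂ : Set _)) ↔
      (∀ y ∈ K₁, 0 ≤ ⟪x.fst, y⟫_ℝ) ∧ ∀ y ∈ K₂, 0 ≤ ⟪x.snd, y⟫_ℝ := by
  rw [ProperCone.mem_innerDual]
  refine ⟨fun h ↦ ⟨fun y hy ↦ ?_, fun y hy ↦ ?_⟩, fun h y hy ↦ ?_⟩
  · have := h (x := WithLp.toLp 2 (y, 0)) ⟨hy, K₂.zero_mem⟩
    simpa [WithLp.prod_inner_apply, real_inner_comm] using this
  · have := h (x := WithLp.toLp 2 (0, y)) ⟨K₁.zero_mem, hy⟩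
    simpa [WithLp.prod_inner_apply, real_inner_comm] using this
  · rw [real_inner_comm, WithLp.prod_inner_apply]
    exact add_nonneg (h.1 _ hy.1) (h.2 _ hy.2)

/-- Farkas' lemma for the polyhedral system `y ∈ L + τ c`, `0 ≤ τ`, `y₁ ∈ V`, `y₂ ∈ K₂`: an
inequality `⟪g, y₁⟫ + β τ ≤ 0` that follows from the system is witnessed by a multiplier `x`. -/
theorem exists_multiplier (V : Submodule ℝ (EuclideanSpace ℝ (Fin n₁)))
    {K₂ : ProperCone ℝ (EuclideanSpace ℝ (Fin n₂))}
    (hK₂ : IsPolyhedralSet (K₂ : Set (EuclideanSpace ℝ (Fin n₂))))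
    (L : Submodule ℝ (EuclideanProd n₁ n₂)) (c : EuclideanProd n₁ n₂)
    (g : EuclideanSpace ℝ (Fin n₁)) (β : ℝ)
    (h : ∀ l ∈ L, ∀ τ : ℝ, 0 ≤ τ → (l + τ • c).fst ∈ V → (l + τ • c).snd ∈ K₂ →
      ⟪g, (l + τ • c).fst⟫_ℝ + β * τ ≤ 0) :
    ∃ x : EuclideanProd n₁ n₂, x ∈ Lᗮ ∧ x.fst - g ∈ Vᗮ ∧ (∀ y ∈ K₂, 0 ≤ ⟪x.snd, y⟫_ℝ) ∧
      ⟪c, x⟫_ℝ ≤ -β := by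
  classical
  obtain ⟨S, hS⟩ := hK₂.exists_homogeneous
  let Y : L × ℝ →ₗ[ℝ] EuclideanProd n₁ n₂ :=
    L.subtype.coprod ((LinearMap.id : ℝ →ₗ[ℝ] ℝ).smulRight c)
  have hY : ∀ l τ, Y (l, τ) = (l : EuclideanProd n₁ n₂) + τ • c := fun l τ ↦ by simp [Y]
  let p₁ : EuclideanProd n₁ n₂ →ₗ[ℝ] EuclideanSpace ℝ (Fin n₁) :=
    WithLp.fstₗ 2 ℝ _ _
  let p₂ : EuclideanProd n₁ n₂ →ₗ[ℝ] EuclideanSpace ℝ (Fin n₂) :=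
    WithLp.sndₗ 2 ℝ _ _
  let T := V.mkQ ∘ₗ p₁ ∘ₗ Y
  let a : Option (EuclideanSpace ℝ (Fin n₂) × ℝ) → L × ℝ →ₗ[ℝ] ℝ := fun o ↦
    o.elim (LinearMap.snd ℝ L ℝ) fun p ↦ -((innerₛₗ ℝ p.1) ∘ₗ p₂ ∘ₗ Y)
  let b : L × ℝ →ₗ[ℝ] ℝ := -((innerₛₗ ℝ g) ∘ₗ p₁ ∘ₗ Y + β • LinearMap.snd ℝ L ℝ)
  obtain ⟨w, ψ, hw, hb⟩ := farkas_linear T S.insertNone a b (by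
    rintro ⟨l, τ⟩ hT ha
    have hτ : 0 ≤ τ := ha none (by simp)
    have h1 : (Y (l, τ)).fst ∈ V := (Submodule.Quotient.mk_eq_zero V).mp hT
    have h2 : (Y (l, τ)).snd ∈ K₂ := (hS _).mpr fun p hp ↦ by
      have : 0 ≤ -⟪p.1, (Y (l, τ)).snd⟫_ℝ := ha (some p) (by simpa using hp)
      linarith
    rw [hY] at h1 h2
    have h3 := h l l.2 τ hτ h1 h2
    rw [← hY] at h3
    exact neg_nonneg.mpr h3)
  let v : EuclideanSpace ℝ (Fin n₁) :=
    (InnerProductSpace.toDual ℝ _).symm (LinearMap.toContinuousLinearMap (ψ ∘ₗ V.mkQ))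
  have hv : ∀ y, ⟪v, y⟫_ℝ = ψ (V.mkQ y) := fun y ↦ InnerProductSpace.toDual_symm_apply
  let k : EuclideanSpace ℝ (Fin n₂) := -∑ p ∈ S, w (some p) • p.1
  have hk : ∀ y, ⟪k, y⟫_ℝ = -∑ p ∈ S, w (some p) * ⟪p.1, y⟫_ℝ := fun y ↦ by
    simp [k, sum_inner, inner_smul_left]
  have key : ∀ (l : L) (τ : ℝ),
      ⟪(WithLp.toLp 2 (g + v, k) : EuclideanProd n₁ n₂), l + τ • c⟫_ℝ
        = -(β + w none) * τ := by
    intro l τ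
    have h1 : -(⟪g, (Y (l, τ)).fst⟫_ℝ + β * τ) = _ := hb (l, τ)
    have h2 : ψ (T (l, τ)) = ⟪v, (Y (l, τ)).fst⟫_ℝ := (hv _).symm
    have h3 : ∑ i ∈ S.insertNone, w i * a i (l, τ) = w none * τ + ⟪k, (Y (l, τ)).snd⟫_ℝ := by
      rw [Finset.sum_insertNone, hk, ← Finset.sum_neg_distrib]
      congr 1
      exact Finset.sum_congr rfl fun p _ ↦ mul_neg _ _
    rw [h2, h3] at h1
    rw [← hY, WithLp.prod_inner_apply]
    change ⟪g + v, (Y (l, τ)).fst⟫_ℝ + ⟪k, (Y (l, τ)).snd⟫_ℝ = _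
    rw [inner_add_left]
    linarith
  refine ⟨WithLp.toLp 2 (g + v, k), ?_, ?_, ?_, ?_⟩
  · rw [Submodule.mem_orthogonal']
    intro l hl
    simpa using key ⟨l, hl⟩ 0
  · rw [Submodule.mem_orthogonal']
    intro y hy
    change ⟪g + v - g, y⟫_ℝ = 0
    rw [add_sub_cancel_left, hv, Submodule.mkQ_apply, (Submodule.Quotient.mk_eq_zero V).mpr hy,
      map_zero]
  · intro y hy
    change 0 ≤ ⟪k, y⟫_ℝ
    rw [hk, neg_nonneg]
    exact Finset.sum_nonpos fun p hp ↦
      mul_nonpos_of_nonneg_of_nonpos (hw _ (by simpa using hp)) ((hS y).mp hy p hp)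
  · have h1 := key 0 1
    rw [Submodule.coe_zero, zero_add, one_smul, mul_one, real_inner_comm] at h1
    have h2 := hw none (by simp)
    linarith

end Product

theorem mainTheorem2 (n₁ n₂ : ℕ)
    (K₁ : ProperCone ℝ (EuclideanSpace ℝ (Fin n₁))) (K₂ : ProperCone ℝ (EuclideanSpace ℝ (Fin n₂)))
    (hK₂ : IsPolyhedralSet (K₂ : Set (EuclideanSpace ℝ (Fin n₂))))
    (L : Submodule ℝ (EuclideanProd n₁ n₂)) (c : EuclideanProd n₁ n₂) :
    ((L : Set (EuclideanProd n₁ n₂)) + {c}) ∩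
        setProd (intrinsicInterior ℝ (K₁ : Set (EuclideanSpace ℝ (Fin n₁)))) (K₂ : Set _) = ∅ ↔
      (∃ x : EuclideanProd n₁ n₂,
          x ∈ ProperCone.innerDual (setProd (K₁ : Set _) (K₂ : Set _)) ∧ x ∈ Lᗮ ∧ ⟪c, x⟫_ℝ < 0) ∨
      (∃ x : EuclideanProd n₁ n₂,
          x ∈ ProperCone.innerDual (setProd (K₁ : Set _) (K₂ : Set _)) ∧ x ∈ Lᗮ ∧ x ∈ (ℝ ∙ c)ᗮ ∧
            x.fst ∉ (Submodule.span ℝ (K₁ : Set (EuclideanSpace ℝ (Fin n₁))))ᗮ) := by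
  constructor
  · intro hempty
    set V := Submodule.span ℝ (K₁ : Set (EuclideanSpace ℝ (Fin n₁)))
    have hKV : ∀ z ∈ K₁, z ∈ V := fun z hz ↦ Submodule.subset_span hz
    let F : Set (EuclideanProd n₁ n₂) := {y | y - c ∈ L ∧ y.fst ∈ V ∧ y.snd ∈ K₂}
    by_cases hF : F.Nonempty
    · let D : Set (EuclideanSpace ℝ (Fin n₁)) := WithLp.fstₗ 2 ℝ _ _ '' F
      have hFc : Convex ℝ F := by
        intro y hy z hz s t hs ht hst
        refine ⟨?_, V.add_mem (V.smul_mem s hy.2.1) (V.smul_mem t hz.2.1),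
          K₂.add_mem (K₂.smul_mem hy.2.2 hs) (K₂.smul_mem hz.2.2 ht)⟩
        have : s • y + t • z - c = s • (y - c) + t • (z - c) := by
          obtain rfl := eq_sub_of_add_eq hst
          module
        rw [this]
        exact L.add_mem (L.smul_mem s hy.1) (L.smul_mem t hz.1)
      obtain ⟨g, hgK, hgD, hgV⟩ := K₁.exists_separating (D := D) (hFc.linear_image _)
        (hF.image _) (by rintro _ ⟨y, hy, rfl⟩; exact hy.2.1)
        (Set.disjoint_left.mpr (by
          rintro _ ⟨y, hy, rfl⟩ hri
          refine Set.eq_empty_iff_forall_notMem.mp hempty y ⟨?_, hri, hy.2.2⟩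
          exact Set.mem_add.mpr ⟨y - c, hy.1, c, rfl, sub_add_cancel y c⟩))
      obtain ⟨y₀, hy₀⟩ := hF
      obtain ⟨x, hxL, hxg, hx₂, hxc⟩ := exists_multiplier V hK₂ L c g 0 (by
        intro l hl τ hτ h1 h2
        rw [zero_mul, add_zero]
        rcases hτ.eq_or_lt with rfl | hτ
        · -- `l` is a recession direction of the feasible set, so `⟪g, l₁⟫` is bounded above along
          -- the ray from `y₀`.
          rw [zero_smul, add_zero] at h1 h2 ⊢
          by_contra! hpos
          set r : ℝ := (1 - ⟪g, y₀.fst⟫_ℝ) / ⟪g, l.fst⟫_ℝ with hr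
          have hy₀D : ⟪g, y₀.fst⟫_ℝ ≤ 0 := hgD _ ⟨y₀, hy₀, rfl⟩
          have hr0 : 0 ≤ r := div_nonneg (by linarith) hpos.le
          have hmem : y₀ + r • l ∈ F := by
            refine ⟨?_, V.add_mem hy₀.2.1 (V.smul_mem r h1),
              K₂.add_mem hy₀.2.2 (K₂.smul_mem h2 hr0)⟩
            rw [add_sub_right_comm]
            exact L.add_mem hy₀.1 (L.smul_mem r hl)
          have h3 : ⟪g, y₀.fst + r • l.fst⟫_ℝ ≤ 0 := hgD _ ⟨_, hmem, rfl⟩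
          rw [inner_add_right, inner_smul_right, hr, div_mul_cancel₀ _ hpos.ne'] at h3
          linarith
        · have hmem : τ⁻¹ • (l + τ • c) ∈ F := by
            refine ⟨?_, V.smul_mem _ h1, K₂.smul_mem h2 (by positivity)⟩
            rw [smul_add, inv_smul_smul₀ hτ.ne', add_sub_cancel_right]
            exact L.smul_mem _ hl
          have h3 : ⟪g, τ⁻¹ • (l + τ • c).fst⟫_ℝ ≤ 0 := hgD _ ⟨_, hmem, rfl⟩
          rw [inner_smul_right] at h3
          exact nonpos_of_mul_nonpos_right h3 (by positivity))
      have hx₁ : ∀ y ∈ K₁, 0 ≤ ⟪x.fst, y⟫_ℝ := fun y hy ↦ by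
        have := (Submodule.mem_orthogonal' _ _).mp hxg y (hKV y hy)
        rw [inner_sub_left, sub_eq_zero] at this
        exact this ▸ hgK y hy
      have hxK := (mem_innerDual_setProd K₁ K₂ x).mpr ⟨hx₁, hx₂⟩
      rw [neg_zero] at hxc
      rcases hxc.lt_or_eq with hlt | heq
      · exact .inl ⟨x, hxK, hxL, hlt⟩
      · refine .inr ⟨x, hxK, hxL, Submodule.mem_orthogonal_singleton_iff_inner_right.mpr heq,
          fun hxV ↦ hgV ?_⟩
        simpa using Vᗮ.sub_mem hxV hxg
    · obtain ⟨x, hxL, hxV, hx₂, hxc⟩ := exists_multiplier V hK₂ L c 0 1 (by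
        intro l hl τ hτ h1 h2
        rw [inner_zero_left, zero_add, one_mul]
        by_contra! hτ
        refine hF ⟨τ⁻¹ • (l + τ • c), ?_, V.smul_mem _ h1, K₂.smul_mem h2 (by positivity)⟩
        rw [smul_add, inv_smul_smul₀ hτ.ne', add_sub_cancel_right]
        exact L.smul_mem _ hl)
      rw [sub_zero] at hxV
      exact .inl ⟨x, (mem_innerDual_setProd K₁ K₂ x).mpr ⟨fun y hy ↦
        ((Submodule.mem_orthogonal' _ _).mp hxV y (hKV y hy)).ge, hx₂⟩, hxL, by linarith⟩
  · intro h
    rw [Set.eq_empty_iff_forall_notMem]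
    rintro y ⟨hyL, hy₁, hy₂⟩
    obtain ⟨l, hl, c', hc', rfl⟩ := Set.mem_add.mp hyL
    obtain rfl := Set.mem_singleton_iff.mp hc'
    have hinner : ∀ x ∈ Lᗮ, ⟪x, l + c'⟫_ℝ = ⟪c', x⟫_ℝ := fun x hx ↦ by
      rw [inner_add_right, (Submodule.mem_orthogonal' _ _).mp hx l hl, zero_add, real_inner_comm]
    rcases h with ⟨x, hxK, hxL, hlt⟩ | ⟨x, hxK, hxL, hxc, hxV⟩
    · obtain ⟨h1, h2⟩ := (mem_innerDual_setProd K₁ K₂ x).mp hxK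
      rw [← hinner x hxL, WithLp.prod_inner_apply] at hlt
      exact absurd (add_nonneg (h1 _ (intrinsicInterior_subset hy₁)) (h2 _ hy₂)) (not_le.mpr hlt)
    · obtain ⟨h1, h2⟩ := (mem_innerDual_setProd K₁ K₂ x).mp hxK
      have h0 := hinner x hxL
      rw [Submodule.mem_orthogonal_singleton_iff_inner_right.mp hxc, WithLp.prod_inner_apply] at h0
      have h3 : 0 ≤ ⟪x.fst, (l + c').fst⟫_ℝ := h1 _ (intrinsicInterior_subset hy₁)
      have h4 : 0 ≤ ⟪x.snd, (l + c').snd⟫_ℝ := h2 _ hy₂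
      have h5 : ⟪x.fst, (l + c').fst⟫_ℝ + ⟪x.snd, (l + c').snd⟫_ℝ = 0 := h0
      exact hxV (K₁.mem_orthogonal_span_of_inner_eq_zero h1 hy₁ (by linarith))
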